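/- Let $\mathcal A$ be a finite alphabet and let $X\subseteq\mathcal A^{\mathbb Z}$ be a nonempty closed set that is invariant under the left shift $\sigma$, $(\sigma x)(n)=x(n+1)$, and its inverse. Suppose that $(X,\sigma)$ is aperiodic (there are no $x\in X$ and $n\ge 1$ with $\sigma^n x=x$) and minimal (for every $x\in X$ the orbit $\{\sigma^n x : n\in\mathbb N\}$ is dense in $X$). Let $P_X(n)$ be the number of words of length $n$ that occur in points of $X$, and suppose that there exists $k\in\mathbb N$ such that $$\liminf_{n\to\infty}\bigl(P_X(n)-kn\bigr)=-\infty .$$ Let $\mathrm{Aut}(X)$ be the group of homeomorphisms $X\to X$ that commute with $\sigma$. Then $\mathrm{Aut}(X)$ is a semidirect product of a finite group and $\mathbb Z$: there are a finite group $F$ and a homomorphism $\varphi\colon\mathbb Z\to\mathrm{Aut}(F)$ such that $\mathrm{Aut}(X)\cong F\rtimes_{\varphi}\mathbb Z$. -/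

import Mathlib

open SymbolicDynamics.FullShift

namespace ShiftAut

variable {A : Type*} [TopologicalSpace A]

/-- The left shift `(σ x) n = x (n + 1)` of a two-sided subshift `X`, as a self-homeomorphism
of `X` (with the topology induced by the product topology on `ℤ → A`). -/
def sigma (X : Subshift A ℤ) : X.carrier ≃ₜ X.carrier where
  toFun x := ⟨shift 1 x.1, X.mapsTo 1 x.2⟩
  invFun x := ⟨shift (-1) x.1, X.mapsTo (-1) x.2⟩
  left_inv x := by
    apply Subtype.ext
    funext n
    simp
  right_inv x := by
    apply Subtype.ext
    funext n
    simp
  continuous_toFun := ((continuous_shift (1 : ℤ)).comp continuous_subtype_val).subtype_mk _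
  continuous_invFun := ((continuous_shift (-1 : ℤ)).comp continuous_subtype_val).subtype_mk _

/-- The automorphism group `Aut(X)`: the centralizer of the shift in the group of
self-homeomorphisms of `X`. -/
def Aut (X : Subshift A ℤ) : Subgroup (X.carrier ≃ₜ X.carrier) :=
  Subgroup.centralizer {sigma X}

/-- The orbit `{σⁿ x : n ∈ ℕ}` of a point of `X`. -/
def orbit (X : Subshift A ℤ) (x : X.carrier) : Set X.carrier :=
  Set.range fun n : ℕ => (sigma X)^[n] x

/-- A subshift is minimal if every point has a dense orbit. -/
def IsMinimal (X : Subshift A ℤ) : Prop :=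
  ∀ x : X.carrier, closure (orbit X x) = Set.univ

/-- A subshift is aperiodic if it has no periodic point, that is, no point `x` with
`σⁿ x = x` for some `n ≥ 1`. -/
def IsAperiodic (X : Subshift A ℤ) : Prop :=
  ∀ x : X.carrier, x ∉ Function.periodicPts (sigma X)

/-- The words of length `n` in the language of `X`. -/
def words (X : Subshift A ℤ) (n : ℕ) : Set (Fin n → A) :=
  {w | ∃ x ∈ X.carrier, ∀ i : Fin n, x (i : ℤ) = w i}

/-- The complexity function `P_X(n)`: the number of words of length `n` in the language of `X`. -/
noncomputable def complexity (X : Subshift A ℤ) (n : ℕ) : ℕ :=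
  (words X n).ncard

end ShiftAut

/-! If k right-infinite words each extend to the left in two ways, then P(n+1) - P(n) ≥ k eventually
and P(n) - kn is bounded below. So the complexity hypothesis leaves finitely many such futures
(`finite_leftSpecialFutures`).

Aperiodicity yields right asymptotic points x ≠ y. An automorphism α has finite radius, so α x and α
y are again distinct and right asymptotic, and the future of α x after their last disagreement is
one of these words. By minimality a future of α x determines α, so modulo σ only finitely many α
exist (`finite_quotient_zpowers_sigmaAut`).

Thus σ is central of infinite order and its powers have finite index. The transfer then maps Aut(X)
to ℤ with finite kernel and infinite image, and such an extension splits because ℤ is free. -/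

/-- A group containing a central element of infinite order whose powers have finite index is
an extension of `ℤ` by a finite group, hence a semidirect product. -/
theorem exists_mulEquiv_finite_semidirectProduct_int {G : Type*} [Group G] (z : G)
    (hz : ∀ g, Commute z g) (hord : orderOf z = 0) (hfin : Finite (G ⧸ Subgroup.zpowers z)) :
    ∃ (F : Type) (_ : Group F) (_ : Finite F) (φ : Multiplicative ℤ →* MulAut F),
      Nonempty (G ≃* F ⋊[φ] Multiplicative ℤ) := by
  classical
  have : (Subgroup.zpowers z).FiniteIndex := Subgroup.finiteIndex_of_finite_quotient
  have hcent : ∀ h ∈ Subgroup.zpowers z, ∀ g, Commute h g := by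
    rintro _ ⟨n, rfl⟩ g
    exact (hz g).zpow_left n
  -- This condition makes the transfer below equal to raising to the power of the index.
  have key : ∀ (g : G) (k : ℕ) (g₀ : G), g₀⁻¹ * g ^ k * g₀ ∈ Subgroup.zpowers z →
      g₀⁻¹ * g ^ k * g₀ = g ^ k := by
    intro g k g₀ h
    have := hcent _ h g₀
    have h2 : g₀ * (g₀⁻¹ * g ^ k * g₀) = g ^ k * g₀ := by group
    rw [← this.eq] at h2
    exact mul_right_cancel h2
  have hinf : Infinite (Subgroup.zpowers z) :=
    Set.infinite_coe_iff.2 (infinite_zpowers.2 (orderOf_eq_zero_iff.1 hord))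
  let e : Multiplicative ℤ ≃* Subgroup.zpowers z := intCyclicMulEquiv
  let τ : G →* Multiplicative ℤ := MonoidHom.transfer e.symm.toMonoidHom
  have hτ : ∀ g, (e (τ g) : G) = g ^ (Subgroup.zpowers z).index := fun g =>
    congrArg Subtype.val (e.symm_apply_eq.1
      (MonoidHom.transfer_eq_pow e.symm.toMonoidHom g (key g)).symm).symm
  have hidx : (Subgroup.zpowers z).index ≠ 0 := Subgroup.FiniteIndex.index_ne_zero
  have hpow : ∀ n : ℤ, z ^ n = 1 → n = 0 := fun n h => by
    have := orderOf_dvd_iff_zpow_eq_one.2 h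
    simpa [hord] using this
  have hkerz : ∀ g ∈ Subgroup.zpowers z, τ g = 1 → g = 1 := by
    rintro _ ⟨n, rfl⟩ h
    have h1 := hτ (z ^ n)
    have h2 : z ^ (n * ((Subgroup.zpowers z).index : ℤ)) = 1 := by
      rw [zpow_mul, zpow_natCast, ← h1]
      simpa using congrArg (fun n => (e n : G)) h
    have := hpow _ h2
    simp only [mul_eq_zero, Nat.cast_eq_zero, hidx, or_false] at this
    simp [this]
  -- The kernel meets the powers of z trivially, so it embeds in the finite quotient.
  have hker : Finite τ.ker := by
    refine Finite.of_injective
      (fun g : τ.ker => (QuotientGroup.mk g.1 : G ⧸ Subgroup.zpowers z)) ?_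
    intro a b hab
    have h1 : a.1⁻¹ * b.1 ∈ Subgroup.zpowers z := QuotientGroup.eq.1 hab
    have h2 := hkerz _ h1 (τ.ker.mul_mem (τ.ker.inv_mem a.2) b.2)
    exact Subtype.ext (inv_mul_eq_one.1 h2)
  have hz1 : z ≠ 1 := by
    rintro rfl
    simp at hord
  have hrange : Infinite τ.range := by
    refine Infinite.of_injective (fun n : ℤ => (⟨τ (z ^ n), z ^ n, rfl⟩ : τ.range)) ?_
    intro m n hmn
    have h1 : τ (z ^ m) = τ (z ^ n) := congrArg Subtype.val hmn
    have h2 := hkerz (z ^ (m - n)) ⟨_, rfl⟩ (by simp [zpow_sub, h1])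
    have := hpow _ h2
    omega
  -- The image of τ may be a proper subgroup of ℤ; being infinite cyclic, it is rescaled to all of
  -- ℤ.
  let e' : Multiplicative ℤ ≃* τ.range := intCyclicMulEquiv
  let π : G →* Multiplicative ℤ := e'.symm.toMonoidHom.comp τ.rangeRestrict
  have hπs : Function.Surjective π :=
    e'.symm.surjective.comp τ.rangeRestrict_surjective
  have hπk : π.ker = τ.ker := by
    ext g
    simp [π, MonoidHom.mem_ker]
  have hπfin : Finite π.ker := by rw [hπk]; exact hker
  obtain ⟨t, ht⟩ := hπs (Multiplicative.ofAdd 1)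
  let s : Multiplicative ℤ →* G := zpowersHom G t
  have hs : ∀ n, π (s n) = n := by
    intro n
    have : π.comp s = MonoidHom.id _ := by
      ext
      simp [s, ht]
    exact DFunLike.congr_fun this n
  let ψ : Multiplicative ℤ →* MulAut π.ker := (MulAut.conjNormal (H := π.ker)).comp s
  let L : π.ker ⋊[ψ] Multiplicative ℤ →* G :=
    SemidirectProduct.lift π.ker.subtype s (by
      intro n
      ext a
      simp [ψ, MulAut.conjNormal_apply])
  have hL : ∀ p, L p = p.left.1 * s p.right := fun p => rfl
  have hLb : Function.Bijective L := by
    constructor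
    · rw [injective_iff_map_eq_one]
      intro p hp
      rw [hL] at hp
      have h1 : p.right = 1 := by
        have := congrArg π hp
        rwa [map_mul, hs, map_one, MonoidHom.mem_ker.1 p.left.2, one_mul] at this
      rw [h1, map_one, mul_one] at hp
      exact SemidirectProduct.ext (Subtype.ext hp) h1
    · intro g
      refine ⟨⟨⟨g * (s (π g))⁻¹, ?_⟩, π g⟩, ?_⟩
      · simp [MonoidHom.mem_ker, hs]
      · simp [hL]
  -- The kernel is finite, so it has a copy in `Type`, whatever the universe of G.
  let eS : π.ker ≃* Shrink.{0} π.ker := Shrink.mulEquiv.{0}.symm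
  refine ⟨Shrink.{0} π.ker, inferInstance, inferInstance,
    (MulAut.congr eS).toMonoidHom.comp ψ, ⟨(MulEquiv.ofBijective L hLb).symm.trans ?_⟩⟩
  exact SemidirectProduct.congr' eS (MulEquiv.refl _)

namespace ShiftAut

/-! ### Powers of the shift and rigidity of automorphisms -/

section Basic

variable {A : Type*} [TopologicalSpace A] {X : Subshift A ℤ}

theorem sigma_apply (x : X.carrier) (i : ℤ) : (sigma X x).1 i = x.1 (1 + i) := rfl

theorem sigma_zpow_apply (n : ℤ) (x : X.carrier) (i : ℤ) :
    ((sigma X ^ n) x).1 i = x.1 (n + i) := by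
  induction n generalizing x with
  | zero => simp
  | succ n ih =>
    rw [zpow_add_one, Homeomorph.mul_apply, ih, sigma_apply]
    ring_nf
  | pred n ih =>
    rw [zpow_sub_one, Homeomorph.mul_apply, ih]
    change x.1 (-1 + (-n + i)) = _
    ring_nf

theorem sigma_iterate_apply (n : ℕ) (x : X.carrier) (i : ℤ) :
    ((sigma X)^[n] x).1 i = x.1 (n + i) := by
  induction n generalizing x with
  | zero => simp
  | succ n ih =>
    rw [Function.iterate_succ_apply, ih, sigma_apply]
    push_cast
    ring_nf

theorem sigma_iterate_zpow_apply (n : ℕ) (m : ℤ) (x : X.carrier) (i : ℤ) :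
    ((sigma X)^[n] ((sigma X ^ m) x)).1 i = x.1 (m + n + i) := by
  rw [sigma_iterate_apply, sigma_zpow_apply, add_assoc]

theorem sigma_mem_Aut : sigma X ∈ Aut X := by
  simp [Aut, Subgroup.mem_centralizer_singleton_iff]

theorem Aut.commute_sigma {α : X.carrier ≃ₜ X.carrier} (hα : α ∈ Aut X) :
    Commute (sigma X) α :=
  (Subgroup.mem_centralizer_singleton_iff.1 hα).symm

theorem Aut.apply_sigma_zpow {α : X.carrier ≃ₜ X.carrier} (hα : α ∈ Aut X) (n i : ℤ)
    (x : X.carrier) : (α ((sigma X ^ n) x)).1 i = (α x).1 (n + i) := by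
  have h := ((Aut.commute_sigma hα).zpow_left n).eq
  have h2 := DFunLike.congr_fun h x
  rw [Homeomorph.mul_apply, Homeomorph.mul_apply] at h2
  rw [← h2, sigma_zpow_apply]

theorem continuous_coord (i : ℤ) : Continuous fun x : X.carrier => x.1 i :=
  (continuous_apply i).comp continuous_subtype_val

theorem IsMinimal.mem_of_forall_iterate_mem (hmin : IsMinimal X) {C : Set X.carrier}
    (hC : IsClosed C) (x : X.carrier) (h : ∀ n : ℕ, (sigma X)^[n] x ∈ C) (y : X.carrier) :
    y ∈ C := by
  have h1 : closure (orbit X x) ⊆ C := hC.closure_subset_iff.2 (by rintro _ ⟨n, rfl⟩; exact h n)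
  exact h1 (by rw [hmin x]; trivial)

/-- Two automorphisms of a minimal subshift whose values at one point are right asymptotic
are equal. -/
theorem IsMinimal.aut_eq_of_rightAsymptotic [T2Space A] (hmin : IsMinimal X)
    {α β : X.carrier ≃ₜ X.carrier} (hα : α ∈ Aut X) (hβ : β ∈ Aut X) (x : X.carrier) (N : ℤ)
    (h : ∀ i, N ≤ i → (α x).1 i = (β x).1 i) : α = β := by
  have hC : IsClosed {z : X.carrier | ∀ n : ℕ, (α z).1 n = (β z).1 n} := by
    rw [Set.ofPred_forall]
    exact isClosed_iInter fun n => isClosed_eq ((continuous_coord _).comp α.continuous)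
      ((continuous_coord _).comp β.continuous)
  have key := hmin.mem_of_forall_iterate_mem hC ((sigma X ^ N) x) (by
    intro n m
    have hn : (sigma X)^[n] ((sigma X ^ N) x) = (sigma X ^ (N + n)) x := by
      apply Subtype.ext
      funext i
      rw [sigma_iterate_zpow_apply, sigma_zpow_apply]
    rw [hn, Aut.apply_sigma_zpow hα, Aut.apply_sigma_zpow hβ]
    exact h _ (by omega))
  ext z i
  have h1 := key ((sigma X ^ i) z) 0
  rw [Aut.apply_sigma_zpow hα, Aut.apply_sigma_zpow hβ] at h1
  simpa using h1

/-- The shift as an element of the automorphism group. -/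
def sigmaAut (X : Subshift A ℤ) : Aut X := ⟨sigma X, sigma_mem_Aut⟩

theorem orderOf_sigmaAut (hne : X.carrier.Nonempty) (haper : IsAperiodic X) :
    orderOf (sigmaAut X) = 0 := by
  rw [orderOf_eq_zero_iff']
  intro n hn h
  obtain ⟨x, hx⟩ := hne
  refine haper ⟨x, hx⟩ (Function.mk_mem_periodicPts hn ?_)
  have h1 : (sigma X ^ (n : ℤ)) = 1 := by
    rw [zpow_natCast]
    exact congrArg Subtype.val h
  apply Subtype.ext
  funext i
  rw [sigma_iterate_apply, ← sigma_zpow_apply, h1]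
  rfl

end Basic

/-! ### Compactness, finite radius and left special words -/

section Compact

variable {A : Type*} [Finite A] [TopologicalSpace A] {X : Subshift A ℤ}

theorem compactSpace_carrier (X : Subshift A ℤ) : CompactSpace X.carrier :=
  isCompact_iff_compactSpace.1 X.isClosed.isCompact

/-- In a nonempty aperiodic subshift there are left special words of every length. -/
theorem IsAperiodic.exists_leftSpecial (haper : IsAperiodic X) (hne : X.carrier.Nonempty)
    (n : ℕ) : ∃ x y : X.carrier, (∀ i ∈ Set.Ico (0 : ℤ) n, x.1 i = y.1 i) ∧
      x.1 (-1) ≠ y.1 (-1) := by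
  by_contra! hcon
  obtain ⟨x₀, hx₀⟩ := hne
  let x : X.carrier := ⟨x₀, hx₀⟩
  -- Without left special words of length n, a window of length n determines the letter before it,
  -- so equal windows have equal pasts.
  have back : ∀ p q : ℤ, (∀ i ∈ Set.Ico (0 : ℤ) n, x₀ (p + i) = x₀ (q + i)) →
      ∀ t : ℕ, ∀ i ∈ Set.Ico (0 : ℤ) n, x₀ (p - t + i) = x₀ (q - t + i) := by
    intro p q hpq t
    induction t with
    | zero => simpa using hpq
    | succ t ih =>
      intro i hi
      have h1 := hcon ((sigma X ^ (p - t)) x) ((sigma X ^ (q - t)) x) (by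
        intro j hj
        rw [sigma_zpow_apply, sigma_zpow_apply]
        exact ih j hj)
      rw [sigma_zpow_apply, sigma_zpow_apply] at h1
      rcases hi.1.eq_or_lt with h0 | h0
      · subst h0
        convert h1 using 2 <;> push_cast <;> ring
      · have := ih (i - 1) ⟨by omega, by have := hi.2; omega⟩
        convert this using 2 <;> push_cast <;> ring
  have back' : ∀ p q : ℤ, (∀ i ∈ Set.Ico (0 : ℤ) n, x₀ (p + i) = x₀ (q + i)) →
      ∀ t : ℕ, x₀ (p - 1 - t) = x₀ (q - 1 - t) := by
    intro p q hpq t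
    have h1 := hcon ((sigma X ^ (p - t)) x) ((sigma X ^ (q - t)) x) (by
      intro j hj
      rw [sigma_zpow_apply, sigma_zpow_apply]
      exact back p q hpq t j hj)
    rw [sigma_zpow_apply, sigma_zpow_apply] at h1
    convert h1 using 2 <;> ring
  obtain ⟨w, hw⟩ := Finite.exists_infinite_fiber
    (fun m : ℕ => fun i : Fin n => x₀ ((m : ℤ) + (i : ℤ)))
  have hinf : (Set.Infinite ((fun m : ℕ => fun i : Fin n => x₀ ((m : ℤ) + (i : ℤ))) ⁻¹' {w})) :=
    Set.infinite_coe_iff.1 hw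
  have agree : ∀ p q : ℕ, (fun i : Fin n => x₀ ((p : ℤ) + (i : ℤ))) = w →
      (fun i : Fin n => x₀ ((q : ℤ) + (i : ℤ))) = w → ∀ t : ℕ,
        x₀ ((p : ℤ) - 1 - t) = x₀ ((q : ℤ) - 1 - t) := by
    intro p q hp hq
    apply back'
    rintro i ⟨hi0, hi1⟩
    lift i to ℕ using hi0
    have := congrFun (hp.trans hq.symm) ⟨i, by omega⟩
    simpa using this
  obtain ⟨a, ha, -⟩ := hinf.exists_gt 0
  obtain ⟨b, hb, hab⟩ := hinf.exists_gt a
  refine haper x (Function.mk_mem_periodicPts (n := b - a) (by omega) ?_)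
  apply Subtype.ext
  funext i
  rw [sigma_iterate_apply]
  -- A third occurrence c, to the right of both i and i + (b - a), has the same past as a and b;
  -- comparing through c gives the period b - a at i.
  obtain ⟨c, hc, hbc⟩ := hinf.exists_gt (b + i.natAbs)
  obtain ⟨t, ht⟩ := Int.eq_ofNat_of_zero_le (a := c - 1 - (i + (b - a))) (by omega)
  obtain ⟨s, hs⟩ := Int.eq_ofNat_of_zero_le (a := c - 1 - i) (by omega)
  have e1 := agree c a hc ha t
  have e2 := agree c b hc hb s
  rw [← ht] at e1
  rw [← hs] at e2
  rw [Nat.cast_sub hab.le]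
  change x₀ _ = x₀ i
  calc x₀ ((b : ℤ) - a + i) = x₀ ((c : ℤ) - 1 - (c - 1 - (i + (b - a)))) := by ring_nf
    _ = x₀ ((b : ℤ) - 1 - (c - 1 - i)) := by rw [e1]; ring_nf
    _ = x₀ i := by rw [← e2]; ring_nf

variable [DiscreteTopology A]

/-- If two points that agree on arbitrarily long parts of a set of coordinates can be separated
by a continuous map, then so can two points that agree on the whole set. -/
theorem exists_ne_of_forall_exists_ne {g : X.carrier → A} (hg : Continuous g) (I : ℕ → Set ℤ)
    (hI : Monotone I)
    (h : ∀ n, ∃ x y : X.carrier, (∀ i ∈ I n, x.1 i = y.1 i) ∧ g x ≠ g y) :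
    ∃ x y : X.carrier, (∀ n, ∀ i ∈ I n, x.1 i = y.1 i) ∧ g x ≠ g y := by
  have := compactSpace_carrier X
  let K : ℕ → Set (X.carrier × X.carrier) := fun n =>
    {p | (∀ i ∈ I n, p.1.1 i = p.2.1 i) ∧ g p.1 ≠ g p.2}
  have hK : ∀ n, IsClosed (K n) := by
    intro n
    refine IsClosed.inter ?_ ?_
    · change IsClosed {p : X.carrier × X.carrier | ∀ i ∈ I n, p.1.1 i = p.2.1 i}
      simp only [Set.ofPred_forall]
      exact isClosed_biInter fun i _ => isClosed_eq ((continuous_coord i).comp continuous_fst)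
        ((continuous_coord i).comp continuous_snd)
    -- Being different is a closed condition because the alphabet is discrete.
    · exact (isClosed_discrete {q : A × A | q.1 ≠ q.2}).preimage
        ((hg.comp continuous_fst).prodMk (hg.comp continuous_snd))
  obtain ⟨p, hp⟩ := IsCompact.nonempty_iInter_of_sequence_nonempty_isCompact_isClosed K
    (fun n p hp => ⟨fun i hi => hp.1 i (hI n.le_succ hi), hp.2⟩)
    (fun n => by obtain ⟨x, y, h1, h2⟩ := h n; exact ⟨(x, y), h1, h2⟩)
    (hK 0).isCompact hK
  rw [Set.mem_iInter] at hp
  exact ⟨p.1, p.2, fun n => (hp n).1, (hp 0).2⟩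

/-- A continuous map to the alphabet depends on finitely many coordinates. -/
theorem exists_radius {g : X.carrier → A} (hg : Continuous g) :
    ∃ R : ℕ, ∀ x y : X.carrier, (∀ i ∈ Set.Icc (-R : ℤ) R, x.1 i = y.1 i) → g x = g y := by
  by_contra! hcon
  obtain ⟨x, y, h1, h2⟩ := exists_ne_of_forall_exists_ne hg (fun n => Set.Icc (-n : ℤ) n)
    (fun m n hmn => Set.Icc_subset_Icc (by omega) (by omega)) hcon
  refine h2 (congrArg g (Subtype.ext (funext fun i => h1 i.natAbs i ?_)))
  constructor <;> omega

/-- A coordinate of α x depends only on a window of fixed radius R, so agreement from N on survives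
from N + R on. -/
theorem Aut.map_rightAsymptotic {α : X.carrier ≃ₜ X.carrier} (hα : α ∈ Aut X)
    {x y : X.carrier} {N : ℤ} (h : ∀ i, N ≤ i → x.1 i = y.1 i) :
    ∃ M : ℤ, ∀ i, M ≤ i → (α x).1 i = (α y).1 i := by
  obtain ⟨R, hR⟩ := exists_radius ((continuous_coord (X := X) 0).comp α.continuous)
  refine ⟨N + R, fun i hi => ?_⟩
  have h1 := hR ((sigma X ^ i) x) ((sigma X ^ i) y) (by
    rintro j ⟨hj, -⟩
    rw [sigma_zpow_apply, sigma_zpow_apply]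
    exact h _ (by omega))
  simp only [Function.comp_apply, Aut.apply_sigma_zpow hα] at h1
  simpa using h1

end Compact

/-! ### Left special words and complexity growth -/

section Complexity

variable {A : Type*} [TopologicalSpace A] {X : Subshift A ℤ}

/-- The words of length `n` that can be extended to the left in at least two ways. -/
def leftSpecialWords (X : Subshift A ℤ) (n : ℕ) : Set (Fin n → A) :=
  {w | ∃ a b : A, a ≠ b ∧ Fin.cons a w ∈ words X (n + 1) ∧ Fin.cons b w ∈ words X (n + 1)}

theorem exists_cons_mem_words {n : ℕ} {w : Fin n → A} (hw : w ∈ words X n) :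
    ∃ a : A, Fin.cons a w ∈ words X (n + 1) := by
  obtain ⟨x, hx, hxw⟩ := hw
  refine ⟨x (-1), shift (-1) x, X.mapsTo (-1) hx, fun i => ?_⟩
  refine Fin.cases ?_ (fun j => ?_) i
  · simp
  · simp [hxw j]

/-- The right-infinite words that can be extended to the left in at least two ways. -/
def leftSpecialFutures (X : Subshift A ℤ) : Set (ℕ → A) :=
  {u | ∃ x y : X.carrier, x.1 (-1) ≠ y.1 (-1) ∧
    (∀ n : ℕ, x.1 n = u n) ∧ ∀ n : ℕ, y.1 n = u n}

theorem restrict_mem_leftSpecialWords {u : ℕ → A} (hu : u ∈ leftSpecialFutures X) (n : ℕ) :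
    (fun i : Fin n => u i) ∈ leftSpecialWords X n := by
  obtain ⟨x, y, hxy, hx, hy⟩ := hu
  have key : ∀ z : X.carrier, (∀ n : ℕ, z.1 n = u n) →
      (Fin.cons (z.1 (-1)) (fun i : Fin n => u i) : Fin (n + 1) → A) ∈ words X (n + 1) := by
    intro z hz
    refine ⟨shift (-1) z.1, X.mapsTo (-1) z.2, fun i => ?_⟩
    refine Fin.cases ?_ (fun j => ?_) i
    · simp
    · simp [hz j]
  exact ⟨_, _, hxy, key x hx, key y hy⟩

theorem eventually_injOn_restrict {A : Type*} (T : Finset (ℕ → A)) :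
    ∀ᶠ n : ℕ in Filter.atTop, Set.InjOn (fun (u : ℕ → A) (i : Fin n) => u i) T := by
  have h : ∀ᶠ n : ℕ in Filter.atTop, ∀ u ∈ T, ∀ v ∈ T,
      (fun i : Fin n => u i) = (fun i : Fin n => v i) → u = v := by
    simp only [Filter.eventually_all_finset]
    intro u _ v _
    by_cases huv : u = v
    · simp [huv]
    · obtain ⟨m, hm⟩ := Function.ne_iff.1 huv
      filter_upwards [Filter.eventually_gt_atTop m] with n hn h
      exact absurd (congrFun h ⟨m, hn⟩) hm
  exact h.mono fun n hn u hu v hv => hn u hu v hv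

theorem le_liminf_of_eventually_add_le {P : ℕ → ℕ} {k : ℕ}
    (h : ∀ᶠ n in Filter.atTop, P n + k ≤ P (n + 1)) :
    Filter.liminf (fun n : ℕ => (((P n : ℝ) - (k : ℝ) * (n : ℝ) : ℝ) : EReal))
      Filter.atTop ≠ ⊥ := by
  obtain ⟨N, hN⟩ := Filter.eventually_atTop.1 h
  have hle : ((-(k * N : ℝ) : ℝ) : EReal) ≤
      Filter.liminf (fun n : ℕ => (((P n : ℝ) - (k : ℝ) * (n : ℝ) : ℝ) : EReal))
        Filter.atTop := by
    refine Filter.le_liminf_of_le (by isBoundedDefault) ?_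
    filter_upwards [Filter.eventually_ge_atTop N] with n hn
    have h1 : k * n ≤ P n + k * N := by
      induction n, hn using Nat.le_induction with
      | base => omega
      | succ n hn ih =>
        have := hN n hn
        rw [mul_add]
        omega
    have h2 : (k : ℝ) * n ≤ P n + k * N := by exact_mod_cast h1
    exact EReal.coe_le_coe_iff.2 (by linarith)
  exact fun hbot => EReal.coe_ne_bot _ (le_bot_iff.1 (hbot ▸ hle))

/-- Two distinct right asymptotic points share a left special future. -/
theorem exists_mem_leftSpecialFutures {x y : X.carrier} (hxy : x ≠ y) {N : ℤ}
    (h : ∀ i, N ≤ i → x.1 i = y.1 i) :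
    ∃ m : ℤ, (fun n : ℕ => x.1 (m + n)) ∈ leftSpecialFutures X := by
  obtain ⟨j, hj⟩ : ∃ j, x.1 j ≠ y.1 j := Function.ne_iff.1 fun h => hxy (Subtype.ext h)
  -- m is the last coordinate where the points differ; the common future starts at m + 1.
  obtain ⟨m, hm, hmax⟩ := Int.exists_greatest_of_bdd (P := fun i => x.1 i ≠ y.1 i)
    ⟨N, fun i hi => le_of_not_ge fun hle => hi (h i hle)⟩ ⟨j, hj⟩
  refine ⟨m + 1, (sigma X ^ (m + 1)) x, (sigma X ^ (m + 1)) y, ?_, fun n => ?_, fun n => ?_⟩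
  · simpa [sigma_zpow_apply] using hm
  · simp [sigma_zpow_apply]
  · rw [sigma_zpow_apply]
    by_contra hne
    have := hmax (m + 1 + n) (Ne.symm hne)
    omega

variable [Finite A]

theorem complexity_add_ncard_leftSpecialWords_le (n : ℕ) :
    complexity X n + (leftSpecialWords X n).ncard ≤ complexity X (n + 1) := by
  obtain hA | hA := isEmpty_or_nonempty A
  · have h1 : words X n = ∅ := Set.eq_empty_of_forall_notMem fun _ ⟨x, _⟩ => hA.elim (x 0)
    have h2 : leftSpecialWords X n = ∅ :=
      Set.eq_empty_of_forall_notMem fun _ ⟨a, _⟩ => hA.elim a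
    simp [complexity, h1, h2]
  -- f picks one left extension of each word, g a second one for the left special words; the
  -- resulting longer words are all distinct.
  choose! f hf using fun w (hw : w ∈ words X n) => exists_cons_mem_words hw
  have hg : ∀ w ∈ leftSpecialWords X n, ∃ b, b ≠ f w ∧ Fin.cons b w ∈ words X (n + 1) := by
    rintro w ⟨a, b, hab, ha, hb⟩
    by_cases h : a = f w
    · exact ⟨b, fun hbf => hab (h.trans hbf.symm), hb⟩
    · exact ⟨a, h, ha⟩
  choose! g hgf hg using hg
  have hinj : ∀ h : (Fin n → A) → A,
      Function.Injective fun w => (Fin.cons (h w) w : Fin (n + 1) → A) :=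
    fun h v w hvw => (Fin.cons_inj.1 hvw).2
  rw [complexity, complexity, ← Set.ncard_image_of_injective _ (hinj f),
    ← Set.ncard_image_of_injective (leftSpecialWords X n) (hinj g),
    ← Set.ncard_union_eq _ (Set.toFinite _) (Set.toFinite _)]
  · refine Set.ncard_le_ncard ?_ (Set.toFinite _)
    rintro _ (⟨w, hw, rfl⟩ | ⟨w, hw, rfl⟩)
    · exact hf w hw
    · exact hg w hw
  · rw [Set.disjoint_left]
    rintro _ ⟨v, -, rfl⟩ ⟨w, hw, hvw⟩
    obtain ⟨h1, rfl⟩ := Fin.cons_inj.1 hvw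
    exact hgf w hw h1

theorem finite_leftSpecialFutures {k : ℕ}
    (hP : Filter.liminf (fun n : ℕ => (((complexity X n : ℝ) - (k : ℝ) * (n : ℝ) : ℝ) : EReal))
      Filter.atTop = ⊥) : (leftSpecialFutures X).Finite := by
  by_contra hinf
  obtain ⟨T, hT, hcard⟩ := Set.Infinite.exists_subset_card_eq hinf k
  refine le_liminf_of_eventually_add_le ?_ hP
  filter_upwards [eventually_injOn_restrict T] with n hn
  refine le_trans ?_ (complexity_add_ncard_leftSpecialWords_le n)
  rw [← hcard, ← Set.ncard_coe_finset, ← hn.ncard_image]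
  refine Nat.add_le_add_left (Set.ncard_le_ncard ?_ (Set.toFinite _)) _
  rintro _ ⟨u, hu, rfl⟩
  exact restrict_mem_leftSpecialWords (hT hu) n

end Complexity

/-! ### Finite index of the powers of the shift -/

section Main

variable {A : Type*} [Finite A] [TopologicalSpace A] [DiscreteTopology A] {X : Subshift A ℤ}

/-- A nonempty aperiodic subshift contains two distinct right asymptotic points. -/
theorem IsAperiodic.exists_rightAsymptotic (haper : IsAperiodic X) (hne : X.carrier.Nonempty) :
    ∃ x y : X.carrier, x ≠ y ∧ ∀ i : ℤ, 0 ≤ i → x.1 i = y.1 i := by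
  obtain ⟨x, y, h1, h2⟩ := exists_ne_of_forall_exists_ne (continuous_coord (X := X) (-1))
    (fun n : ℕ => Set.Ico (0 : ℤ) n) (fun m n hmn => Set.Ico_subset_Ico_right (by omega))
    (haper.exists_leftSpecial hne)
  refine ⟨x, y, fun h => h2 (by rw [h]), fun i hi => h1 (i.toNat + 1) i ?_⟩
  constructor <;> omega

theorem finite_quotient_zpowers_sigmaAut (hne : X.carrier.Nonempty) (haper : IsAperiodic X)
    (hmin : IsMinimal X) (hfin : (leftSpecialFutures X).Finite) :
    Finite (Aut X ⧸ Subgroup.zpowers (sigmaAut X)) := by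
  obtain ⟨x, y, hxy, h⟩ := haper.exists_rightAsymptotic hne
  have hex : ∀ α : Aut X, ∃ m : ℤ, (fun n : ℕ => (α.1 x).1 (m + n)) ∈ leftSpecialFutures X := by
    intro α
    obtain ⟨M, hM⟩ := Aut.map_rightAsymptotic α.2 h
    exact exists_mem_leftSpecialFutures (α.1.injective.ne hxy) hM
  choose m hm using hex
  have : Finite (leftSpecialFutures X) := hfin
  refine Finite.of_injective (fun q : Aut X ⧸ Subgroup.zpowers (sigmaAut X) =>
    (⟨_, hm q.out⟩ : leftSpecialFutures X)) ?_
  intro p q hpq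
  have hpq' := congrArg Subtype.val hpq
  -- Equal futures mean that the two representatives, each composed with its power of σ, agree at x
  -- on coordinates ≥ 0.
  have heq := hmin.aut_eq_of_rightAsymptotic
    (mul_mem p.out.2 (zpow_mem sigma_mem_Aut (m p.out)))
    (mul_mem q.out.2 (zpow_mem sigma_mem_Aut (m q.out))) x 0 (by
      intro i hi
      lift i to ℕ using hi
      rw [Homeomorph.mul_apply, Homeomorph.mul_apply, Aut.apply_sigma_zpow p.out.2,
        Aut.apply_sigma_zpow q.out.2]
      exact congrFun hpq' i)
  have heq' : p.out * sigmaAut X ^ m p.out = q.out * sigmaAut X ^ m q.out := Subtype.ext heq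
  rw [← QuotientGroup.out_eq' p, ← QuotientGroup.out_eq' q, QuotientGroup.eq]
  refine ⟨m p.out - m q.out, ?_⟩
  change sigmaAut X ^ (m p.out - m q.out) = _
  rw [eq_inv_mul_iff_mul_eq, zpow_sub, ← mul_assoc, heq', mul_inv_cancel_right]

end Main

end ShiftAut

theorem mainTheorem7 {A : Type*} [Finite A] [TopologicalSpace A] [DiscreteTopology A]
    (X : Subshift A ℤ) (hne : X.carrier.Nonempty)
    (haper : ShiftAut.IsAperiodic X) (hmin : ShiftAut.IsMinimal X)
    (hP : ∃ k : ℕ, Filter.liminf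
      (fun n : ℕ => (((ShiftAut.complexity X n : ℝ) - (k : ℝ) * (n : ℝ) : ℝ) : EReal))
      Filter.atTop = ⊥) :
    ∃ (F : Type) (_ : Group F) (_ : Finite F) (φ : Multiplicative ℤ →* MulAut F),
      Nonempty (ShiftAut.Aut X ≃* F ⋊[φ] Multiplicative ℤ) := by
  obtain ⟨k, hk⟩ := hP
  exact exists_mulEquiv_finite_semidirectProduct_int (ShiftAut.sigmaAut X)
    (fun α => Subtype.ext (ShiftAut.Aut.commute_sigma α.2).eq)
    (ShiftAut.orderOf_sigmaAut hne haper)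
    (ShiftAut.finite_quotient_zpowers_sigmaAut hne haper hmin
      (ShiftAut.finite_leftSpecialFutures hk))
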